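/- For $k\ge 2$ let $\mathrm{LO}_k$ be the set of triples $(a,b,c)\in\{0,\dots,k-1\}^3$ whose maximum is attained exactly once. An $n$-ary polymorphism of $(\mathbf{LO}_2,\mathbf{LO}_3)$ is a function $f:\{0,1\}^n\to\{0,1,2\}$ such that for every $3\times n$ matrix over $\{0,1\}$ all of whose columns lie in $\mathrm{LO}_2$, applying $f$ to the three rows gives a triple in $\mathrm{LO}_3$. Identify tuples in $\{0,1\}^n$ with subsets of $[n]=\{1,\dots,n\}$, and write $f(X)$ for $X\subseteq[n]$. For a polymorphism $f$: - $X$ is a *$2$-set* if $f(X)=2$, and a *boolean set* if $f(X)\in\{0,1\}$. A $2$-set is *small* if it has at most three elements. - For $i\ne f(X)$, *recolouring $X$ to $i$* means replacing the value $f(X)$ by $i$ and leaving all other values unchanged; $X$ is *$i$-recolourable* if the result is again a polymorphism. A boolean set $X$ is *static* if it is not $(1-f(X))$-recolourable. - $f$ is a *recoloured projection with dictating variable* $t\in[n]$ if every static boolean set $S$ of $f$ satisfies $f(S)=1$ when $t\in S$ and $f(S)=0$ when $t\notin S$. - $f$ is *saturated* if every superset of a $2$-set is a $2$-set and the complement of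 every boolean set is a $2$-set. - A *pure saturation* of $f$ is a saturated polymorphism $g$ without small $2$-sets for which there is a finite sequence of polymorphisms $f=f_1,f_2,\dots,f_l=g$ ($l\ge 1$) such that each $f_i$ with $i\ge 2$ is obtained from $f_{i-1}$ by recolouring a boolean set to $2$. **Theorem.** Let $f$ be an $n$-ary polymorphism of $(\mathbf{LO}_2,\mathbf{LO}_3)$ that has no small $2$-sets. Then there exists a unique $t\in[n]$ (depending on $f$) such that the following holds: either $n\le 6$ and $f$ is a recoloured projection with dictating variable $t$, or $n\ge 7$ and every pure saturation of $f$ is a recoloured projection with dictating variable $t$. -/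

import Mathlib

namespace LOPoly

/-- The relation `LO_k`: triples over `{0, …, k-1}` whose maximum is attained exactly once. -/
def LO (k : ℕ) : Set (Fin 3 → Fin k) :=
  {v | ∃ i, ∀ j, j ≠ i → v j < v i}

/-- `f : Aⁿ → B` is a polymorphism of the pair of structures `((A; R), (B; S))`, with `R` and `S`
ternary: for every `3 × n` matrix all of whose columns belong to `R`, applying `f` to the rows
gives a triple in `S`. -/
def IsPolymorphism {A B : Type*} (R : Set (Fin 3 → A)) (S : Set (Fin 3 → B)) {n : ℕ}
    (f : (Fin n → A) → B) : Prop :=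
  ∀ M : Fin 3 → Fin n → A, (∀ j, (fun i => M i j) ∈ R) → (fun i => f (M i)) ∈ S

/-- `n`-ary polymorphisms of the template `(LO_2, LO_3)`. -/
def IsLOPol {n : ℕ} (f : (Fin n → Fin 2) → Fin 3) : Prop :=
  IsPolymorphism (LO 2) (LO 3) f

/-- The tuple in `{0,1}ⁿ` that has a `1` exactly in the positions in `X`. -/
def tuple {n : ℕ} (X : Finset (Fin n)) : Fin n → Fin 2 :=
  fun j => if j ∈ X then 1 else 0

/-- `f(X)` for a subset `X` of the index set, identified with its indicator tuple. -/
def val {n : ℕ} (f : (Fin n → Fin 2) → Fin 3) (X : Finset (Fin n)) : Fin 3 :=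
  f (tuple X)

/-- `X` is a boolean set of `f`: `f(X) ∈ {0,1}`. -/
def IsBoolean {n : ℕ} (f : (Fin n → Fin 2) → Fin 3) (X : Finset (Fin n)) : Prop :=
  val f X = 0 ∨ val f X = 1

/-- `f` has no small `2`-set, that is, no `2`-set with at most three elements. -/
def NoSmallTwoSet {n : ℕ} (f : (Fin n → Fin 2) → Fin 3) : Prop :=
  ∀ X : Finset (Fin n), val f X = 2 → 3 < X.card

/-- The map that agrees with `f` except that `X` gets the value `i`. -/
def recolour {n : ℕ} (f : (Fin n → Fin 2) → Fin 3) (X : Finset (Fin n)) (i : Fin 3) :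
    (Fin n → Fin 2) → Fin 3 :=
  Function.update f (tuple X) i

/-- `X` is `i`-recolourable for `f`. -/
def Recolourable {n : ℕ} (f : (Fin n → Fin 2) → Fin 3) (X : Finset (Fin n)) (i : Fin 3) : Prop :=
  i ≠ val f X ∧ IsLOPol (recolour f X i)

/-- `X` is a static boolean set of `f`: it is boolean and cannot be recoloured to its opposite
boolean value. -/
def IsStatic {n : ℕ} (f : (Fin n → Fin 2) → Fin 3) (X : Finset (Fin n)) : Prop :=
  (val f X = 0 ∧ ¬ Recolourable f X 1) ∨ (val f X = 1 ∧ ¬ Recolourable f X 0)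

/-- `f` is a recoloured projection with dictating variable `t`. -/
def IsRecolouredProjection {n : ℕ} (f : (Fin n → Fin 2) → Fin 3) (t : Fin n) : Prop :=
  IsLOPol f ∧ ∀ S : Finset (Fin n), IsStatic f S → val f S = if t ∈ S then 1 else 0

/-- Supersets of `2`-sets are `2`-sets. -/
def UpwardsClosed {n : ℕ} (f : (Fin n → Fin 2) → Fin 3) : Prop :=
  ∀ X Y : Finset (Fin n), val f X = 2 → X ⊆ Y → val f Y = 2

/-- Saturated polymorphisms: upwards closed, and the complement of every boolean set is a
`2`-set. -/
def IsSaturated {n : ℕ} (f : (Fin n → Fin 2) → Fin 3) : Prop :=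
  IsLOPol f ∧ UpwardsClosed f ∧ ∀ X : Finset (Fin n), IsBoolean f X → val f Xᶜ = 2

/-- `f'` is a polymorphism obtained from `f` by recolouring one boolean set to `2`. -/
def TwoStep {n : ℕ} (f f' : (Fin n → Fin 2) → Fin 3) : Prop :=
  ∃ X : Finset (Fin n), IsBoolean f X ∧ Recolourable f X 2 ∧ f' = recolour f X 2

/-- `g` is a saturation of `f`: `g` is saturated, and it is reached from `f` through a finite
(possibly trivial) sequence of polymorphisms, each obtained from the previous one by recolouring
a boolean set to `2`. -/
def IsSaturation {n : ℕ} (f g : (Fin n → Fin 2) → Fin 3) : Prop :=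
  IsLOPol f ∧ IsSaturated g ∧ Relation.ReflTransGen TwoStep f g

/-- A saturation without small `2`-sets. -/
def IsPureSaturation {n : ℕ} (f g : (Fin n → Fin 2) → Fin 3) : Prop :=
  IsSaturation f g ∧ NoSmallTwoSet g

end LOPoly

/-! By `isLOPol_iff`, a polymorphism is a map whose 2-sets pairwise intersect and whose
tripartitions into boolean sets have exactly one part of value 1. A boolean set is static exactly
when it occurs in such a tripartition, so a recoloured projection is a polymorphism in which the
part containing `t` always has value 1.

The 2-sets of a saturated polymorphism form a game. Take a winning set `W` of least size; without
small 2-sets it has at least four elements. Proper subsets of `W` lose, and so do subsets missing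
two elements of `W` after one extra element is added; this supplies enough losing tripartitions. If
`h Wᶜ = 0`, the values on nonempty proper subsets of `W` are those of a projection to some `t ∈ W`.
If `h Wᶜ = 1`, they all vanish, and the dictator is the unique `d ∉ W` with `h (Wᶜ \ {d}) = 0`. This
gives `IsGame.exists_dictates`.

The dictator does not depend on the saturation (`Dictates.eq`). One game is turned into another by
exchanging minimal winning sets with their complements, and each exchange keeps the dictator, since
any two elements are separated by a tripartition losing before and after. For `n ≥ 7` a pure
saturation exists, which makes `t` unique. For `n ≤ 6` all sets of at most three elements are
boolean, and an affine formula on six points forces a projection. -/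

namespace LOPoly

set_option linter.unusedSectionVars false

/-! ### Games and their dictators -/

section Games

variable {α : Type*} [DecidableEq α] [Fintype α]

/-- The sets `X`, `Y`, `Z` (possibly empty) partition the ground set. -/
def Tripartition (X Y Z : Finset α) : Prop :=
  ∀ a, (a ∈ X ∧ a ∉ Y ∧ a ∉ Z) ∨ (a ∉ X ∧ a ∈ Y ∧ a ∉ Z) ∨ (a ∉ X ∧ a ∉ Y ∧ a ∈ Z)

/-- Every tripartition that avoids `F` has exactly one part of value `1`. -/
def OneInThree (F : Finset (Finset α)) (h : Finset α → ℕ) : Prop :=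
  ∀ X Y Z, Tripartition X Y Z → X ∉ F → Y ∉ F → Z ∉ F → h X + h Y + h Z = 1

/-- In every tripartition that avoids `F`, the part containing `t` has value `1`. -/
def Dictates (F : Finset (Finset α)) (h : Finset α → ℕ) (t : α) : Prop :=
  ∀ X Y Z, Tripartition X Y Z → X ∉ F → Y ∉ F → Z ∉ F → t ∈ X → h X = 1

/-- A family of winning sets that is closed upwards and contains exactly one of any two
complementary sets. -/
structure IsGame (T : Finset (Finset α)) : Prop where
  up : ∀ X Y, X ∈ T → X ⊆ Y → Y ∈ T
  compl : ∀ X, X ∈ T ↔ Xᶜ ∉ T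

variable {F T : Finset (Finset α)} {h : Finset α → ℕ}

namespace IsGame

theorem lose_of_subset (hT : IsGame T) {X Y : Finset α} (hY : Y ∉ T) (hXY : X ⊆ Y) : X ∉ T :=
  fun hX => hY (hT.up X Y hX hXY)

theorem lose_of_disjoint (hT : IsGame T) {X Y : Finset α} (hY : Y ∈ T) (hXY : X ⊆ Yᶜ) :
    X ∉ T :=
  hT.lose_of_subset ((hT.compl Y).1 hY) hXY

theorem win_of_cover (hT : IsGame T) {X Y : Finset α} (hY : Y ∉ T) (hXY : Yᶜ ⊆ X) : X ∈ T := by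
  by_contra hX
  exact hT.lose_of_subset hX hXY (by by_contra h; exact hY ((hT.compl Y).2 h))

end IsGame

/-- Adding the elements of `C` to the losing set `X` one by one, some element is pivotal. -/
theorem exists_pivot {X C : Finset α} (hX : X ∉ T) (hXC : X ∪ C ∈ T) :
    ∃ D e, D ⊆ C ∧ e ∈ C ∧ e ∉ D ∧ X ∪ D ∉ T ∧ X ∪ insert e D ∈ T := by
  induction C using Finset.induction_on with
  | empty => simp_all
  | insert e D he ih =>
    by_cases hD : X ∪ D ∈ T
    · obtain ⟨D', e', h1, h2, h3⟩ := ih hD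
      exact ⟨D', e', by grind, by grind, h3⟩
    · exact ⟨D, e, by grind, by grind, he, hD, hXC⟩

/-- `W` is a winning set with at least four elements of the smallest possible size. -/
structure IsMinWin (T : Finset (Finset α)) (W : Finset α) : Prop where
  win : W ∈ T
  four : 4 ≤ W.card
  le : ∀ X ∈ T, W.card ≤ X.card

namespace IsMinWin

variable {W : Finset α}

theorem lose_ssubset (hW : IsMinWin T W) {U : Finset α} (hU : U ⊂ W) : U ∉ T := fun h =>
  absurd (hW.le U h) (by have := Finset.card_lt_card hU; omega)

theorem lose_insert (hW : IsMinWin T W) {U : Finset α} (d : α) (hU : U ⊆ W)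
    (hc : 2 ≤ (W \ U).card) : insert d U ∉ T := fun h => by
  have h1 := hW.le _ h
  have h2 := Finset.card_insert_le d U
  have h3 := Finset.card_sdiff_add_card_eq_card hU
  omega

theorem exists_ne (hW : IsMinWin T W) (u : α) : ∃ v ∈ W, v ≠ u := by
  have := hW.four
  exact Finset.exists_mem_ne (by omega) u

theorem exists_ne_ne (hW : IsMinWin T W) (u v : α) : ∃ w ∈ W, w ≠ u ∧ w ≠ v := by
  have h1 := hW.four
  have h2 : 0 < (W \ {u, v}).card := by
    have := Finset.le_card_sdiff {u, v} W
    have := Finset.card_le_two (a := u) (b := v)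
    omega
  obtain ⟨w, hw⟩ := Finset.card_pos.1 h2
  exact ⟨w, by grind, by grind, by grind⟩

theorem exists_pair (hW : IsMinWin T W) :
    ∃ U ⊆ W, 2 ≤ U.card ∧ 2 ≤ (W \ U).card := by
  have h1 := hW.four
  obtain ⟨U, hU, hc⟩ := Finset.exists_subset_card_eq (s := W) (n := 2) (by omega)
  have h3 := Finset.card_sdiff_add_card_eq_card hU
  exact ⟨U, hU, by omega, by omega⟩

theorem two_le_sdiff_singleton (hW : IsMinWin T W) (u : α) : 2 ≤ (W \ {u}).card := by
  have h1 := hW.four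
  have := Finset.le_card_sdiff {u} W
  simp at this
  omega

/-- A set with a nonempty proper trace `U` on `W`, together with `W \ U` and the rest. -/
theorem rule_trace (hT : IsGame T) (hW : IsMinWin T W) (hh : OneInThree T h) {U D : Finset α}
    (hU : U ⊂ W) (hne : U.Nonempty) (hD : D ⊆ Wᶜ) (hl : U ∪ D ∉ T) :
    h (U ∪ D) + h (W \ U) + h (Wᶜ \ D) = 1 := by
  refine hh _ _ _ ?_ hl (hW.lose_ssubset ?_) (hT.lose_of_disjoint hW.win ?_)
  · intro a; grind [Finset.mem_compl]
  · obtain ⟨u, hu⟩ := hne; refine ⟨by grind, fun h => ?_⟩; have := h (hU.1 hu); grind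
  · grind [Finset.mem_compl]

theorem rule_bipartition (hT : IsGame T) (hW : IsMinWin T W) (hh : OneInThree T h)
    {U : Finset α} (hU : U ⊂ W) (hne : U.Nonempty) :
    h U + h (W \ U) + h Wᶜ = 1 := by
  have := hW.rule_trace hT hh hU hne (D := ∅) (by simp) (by simpa using hW.lose_ssubset hU)
  simpa using this

/-- Moving one outside element `d` into a small part of `W`. -/
theorem rule_insert (hT : IsGame T) (hW : IsMinWin T W) (hh : OneInThree T h)
    {U : Finset α} {d : α} (hU : U ⊆ W) (hne : U.Nonempty) (hc : 2 ≤ (W \ U).card) (hd : d ∉ W) :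
    h (insert d U) + h (W \ U) + h (Wᶜ \ {d}) = 1 := by
  have := hW.rule_trace hT hh (U := U) (D := {d}) ⟨hU, fun h => by
      have : W \ U = ∅ := by grind
      simp [this] at hc⟩ hne (by grind [Finset.mem_compl])
    (by have := hW.lose_insert d hU hc; rwa [Finset.insert_eq, Finset.union_comm] at this)
  rwa [Finset.union_comm, ← Finset.insert_eq] at this

/-! ### The complement of `W` has value `0` -/

/-- A parity argument: `h A + h (W \ A) = 1`, so adding the rules for moving `e` into `A` and into
`W \ A` leaves `2 * h (Wᶜ \ {e}) ≤ 1`. -/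
theorem value_compl_sdiff_singleton (hT : IsGame T) (hW : IsMinWin T W) (hh : OneInThree T h)
    (hC : h Wᶜ = 0) {e : α} (he : e ∉ W) : h (Wᶜ \ {e}) = 0 := by
  obtain ⟨A, hA, h1, h2⟩ := hW.exists_pair
  have hA' : A ≠ ∅ := by rintro rfl; simp at h1
  have hB' : W \ A ≠ ∅ := by intro h; simp [h] at h2
  have hA'' := Finset.nonempty_iff_ne_empty.2 hA'
  have hB'' := Finset.nonempty_iff_ne_empty.2 hB'
  have e0 : W \ (W \ A) = A := Finset.sdiff_sdiff_eq_self hA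
  have e1 := hW.rule_insert hT hh hA hA'' h2 he
  have e2 := hW.rule_insert hT hh (U := W \ A) Finset.sdiff_subset hB'' (by rwa [e0]) he
  have e3 := hW.rule_bipartition hT hh (U := A)
    ⟨hA, fun h => hB' (Finset.sdiff_eq_empty_iff_subset.2 h)⟩ hA''
  rw [e0] at e2
  omega

/-- If removing `d` raised the value to 1, then `W \ U` would have value 0 and `U ∪ D` value 1, so
the tripartition in `e4` would contain two ones. The bound on `U` keeps `insert d (W \ U)` losing.
-/
theorem value_compl_sdiff (hT : IsGame T) (hW : IsMinWin T W) (hh : OneInThree T h)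
    (hC : h Wᶜ = 0) {U D : Finset α} (hU : U ⊂ W) (hc : 2 ≤ U.card) (hD : D ⊆ Wᶜ)
    (hl : U ∪ D ∉ T) : h (Wᶜ \ D) = 0 := by
  have hne : U.Nonempty := Finset.card_pos.1 (by omega)
  have hne' : (W \ U).Nonempty := Finset.sdiff_nonempty.2 hU.2
  have e0 : W \ (W \ U) = U := Finset.sdiff_sdiff_eq_self hU.1
  induction D using Finset.induction_on with
  | empty => simpa using hC
  | insert d D hd ih =>
    have hl' : U ∪ D ∉ T := hT.lose_of_subset hl (by grind)
    have hD' : D ⊆ Wᶜ := by grind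
    have hdW : d ∉ W := by grind [Finset.mem_compl]
    have ih := ih hD' hl'
    have e1 := hW.rule_trace hT hh hU hne hD hl
    have e2 := hW.rule_trace hT hh hU hne hD' hl'
    have e3 := hW.rule_bipartition hT hh hU hne
    have e4 : h (U ∪ D) + h (insert d (W \ U)) + h (Wᶜ \ insert d D) = 1 := by
      refine hh _ _ _ ?_ hl' (hW.lose_insert d Finset.sdiff_subset (by rwa [e0]))
        (hT.lose_of_disjoint hW.win ?_)
      · intro a; have := @hU.1 a; grind [Finset.mem_compl]
      · grind
    omega

/-- Outside elements are added to `A ∪ B` up to a pivot `e`. In the losing tripartition `A ∪ D`,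
`insert e B`, `Q` with the rest, the first two values are those of `A` and `B`, and the third is at
most `h Q`. -/
theorem rule_three_aux (hT : IsGame T) (hW : IsMinWin T W) (hh : OneInThree T h)
    (hC : h Wᶜ = 0) {A B Q : Finset α} (hA : A.Nonempty) (hB : B.Nonempty) (hQ : Q.Nonempty)
    (hAB : Disjoint A B) (hAQ : Disjoint A Q) (hBQ : Disjoint B Q) (hu : A ∪ B ∪ Q = W) :
    h A + h B + h Q = 1 ∨ h A + h B + h Q = 2 ∧ h Q = 1 := by
  rw [Finset.disjoint_left] at hAB hAQ hBQ
  obtain ⟨a, ha⟩ := hA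
  obtain ⟨b, hb⟩ := hB
  obtain ⟨q, hq⟩ := hQ
  have sA : A ⊂ W := ⟨by grind, fun h => by have := @h b; grind⟩
  have sB : B ⊂ W := ⟨by grind, fun h => by have := @h a; grind⟩
  have sAB : A ∪ B ⊂ W := ⟨by grind, fun h => by have := @h q; grind⟩
  have sQ : Q ⊂ W := ⟨by grind, fun h => by have := @h a; grind⟩
  have c2 : 2 ≤ (A ∪ B).card := by
    rw [Finset.card_union_of_disjoint (Finset.disjoint_left.2 hAB)]
    have := Finset.card_pos.2 ⟨a, ha⟩
    have := Finset.card_pos.2 ⟨b, hb⟩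
    omega
  have cB : 2 ≤ (W \ B).card := by
    have : W \ B = A ∪ Q := by grind
    rw [this, Finset.card_union_of_disjoint (Finset.disjoint_left.2 hAQ)]
    have := Finset.card_pos.2 ⟨a, ha⟩
    have := Finset.card_pos.2 ⟨q, hq⟩
    omega
  have lQ : Q ∉ T := hW.lose_ssubset sQ
  obtain ⟨D, e, hD, he, heD, hl, hw⟩ := exists_pivot (X := A ∪ B) (C := Wᶜ)
    (hW.lose_ssubset sAB) (hT.win_of_cover lQ (by intro x; grind [Finset.mem_compl]))
  have heW : e ∉ W := by grind [Finset.mem_compl]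
  have lBe := hW.lose_insert e sB.1 cB
  have lAD : A ∪ D ∉ T := hT.lose_of_subset hl (by grind)
  have lQE : Q ∪ (Wᶜ \ insert e D) ∉ T :=
    hT.lose_of_disjoint hw (by intro x; grind [Finset.mem_compl])
  have e1 : h (A ∪ D) + h (insert e B) + h (Q ∪ (Wᶜ \ insert e D)) = 1 := by
    refine hh _ _ _ ?_ lAD lBe lQE
    intro x; have := @hD x; have := @hAB x; have := @hAQ x; have := @hBQ x
    grind [Finset.mem_compl]
  have e2 := hW.rule_insert hT hh sB.1 ⟨b, hb⟩ cB heW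
  have e3 := hW.rule_trace hT hh sA ⟨a, ha⟩ hD lAD
  have e4 := hW.rule_trace hT hh sQ ⟨q, hq⟩ Finset.sdiff_subset lQE
  have e5 := hW.rule_bipartition hT hh sA ⟨a, ha⟩
  have e6 := hW.rule_bipartition hT hh sB ⟨b, hb⟩
  have e7 := hW.rule_bipartition hT hh sQ ⟨q, hq⟩
  have e8 := hW.value_compl_sdiff_singleton hT hh hC heW
  have e9 := hW.value_compl_sdiff hT hh hC sAB c2 hD hl
  omega

/-- With each part in turn in the last place, a sum of 2 would force all three values to be 1. -/
theorem rule_three (hT : IsGame T) (hW : IsMinWin T W) (hh : OneInThree T h)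
    (hC : h Wᶜ = 0) {A B Q : Finset α} (hA : A.Nonempty) (hB : B.Nonempty) (hQ : Q.Nonempty)
    (hAB : Disjoint A B) (hAQ : Disjoint A Q) (hBQ : Disjoint B Q) (hu : A ∪ B ∪ Q = W) :
    h A + h B + h Q = 1 := by
  have h1 := hW.rule_three_aux hT hh hC hA hB hQ hAB hAQ hBQ hu
  have h2 := hW.rule_three_aux hT hh hC hA hQ hB hAQ hAB hBQ.symm (by grind)
  have h3 := hW.rule_three_aux hT hh hC hB hQ hA hBQ hAB.symm hAQ.symm (by grind)
  omega

/-- If the complement of `W` has value `0`, the values on `W` are those of a projection. -/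
theorem exists_dictator_inside (hT : IsGame T) (hW : IsMinWin T W) (hh : OneInThree T h)
    (hC : h Wᶜ = 0) :
    ∃ t ∈ W, ∀ U, U ⊂ W → U.Nonempty → h U = if t ∈ U then 1 else 0 := by
  -- A set of value 1 shrinks to a singleton: the complement in `W` has value 0, so the three-part
  -- rule passes the 1 to `{u}` or to `U`.
  have key : ∀ U : Finset α, U ⊂ W → U.Nonempty → h U = 1 → ∃ t ∈ W, h {t} = 1 := by
    intro U
    induction U using Finset.induction_on with
    | empty => simp
    | insert u U hu ih =>
      intro hs _ h1
      rcases U.eq_empty_or_nonempty with rfl | hne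
      · exact ⟨u, by grind, by simpa using h1⟩
      · have e1 := hW.rule_three hT hh hC (A := {u}) (B := U) (Q := W \ insert u U) (by simp) hne
          (Finset.sdiff_nonempty.2 hs.2) (by simpa) (by rw [Finset.disjoint_left]; grind)
          (by rw [Finset.disjoint_left]; grind) (by have := hs.1; grind)
        have e2 := hW.rule_bipartition hT hh hs (by simp)
        have hU : U ⊂ W := ⟨by have := hs.1; grind, fun h => by have := hs.1; have := @h u; grind⟩
        by_cases hu1 : h {u} = 1
        · exact ⟨u, hs.1 (by simp), hu1⟩
        · exact ih hU hne (by omega)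
  have hne : ∃ t ∈ W, h {t} = 1 := by
    obtain ⟨A, hA, h1, h2⟩ := hW.exists_pair
    have hA' : A.Nonempty := Finset.card_pos.1 (by omega)
    have hB' : (W \ A).Nonempty := Finset.card_pos.1 (by omega)
    have hs : A ⊂ W := ⟨hA, Finset.sdiff_nonempty.1 hB'⟩
    have e := hW.rule_bipartition hT hh hs hA'
    by_cases hA1 : h A = 1
    · exact key A hs hA' hA1
    · refine key (W \ A) ⟨Finset.sdiff_subset, fun h => ?_⟩ hB' (by omega)
      obtain ⟨x, hx⟩ := hA'
      have := h (hA hx)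
      grind
  obtain ⟨t, htW, ht⟩ := hne
  have zero : ∀ V, V ⊂ W → V.Nonempty → t ∉ V → h V = 0 := by
    intro V hV hVne htV
    have hts : {t} ⊂ W := ⟨by simpa, fun h => by
      obtain ⟨v, hv, hvt⟩ := hW.exists_ne t
      have := h hv
      grind⟩
    have e1 := hW.rule_bipartition hT hh hts (by simp)
    rcases (W \ insert t V).eq_empty_or_nonempty with he | hne
    · have : V = W \ {t} := by
        have := hV.1
        rw [Finset.sdiff_eq_empty_iff_subset] at he
        ext x; have := @he x; grind
      rw [this]; omega
    · have := hW.rule_three hT hh hC (A := {t}) (B := V) (Q := W \ insert t V) (by simp) hVne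
        hne (by simpa) (by rw [Finset.disjoint_left]; grind)
        (by rw [Finset.disjoint_left]; grind) (by have := hV.1; grind)
      omega
  refine ⟨t, htW, fun U hU hUne => ?_⟩
  split_ifs with htU
  · have e1 := hW.rule_bipartition hT hh hU hUne
    have e2 := zero (W \ U) ⟨Finset.sdiff_subset, fun h => by have := h htW; grind⟩
      (Finset.sdiff_nonempty.2 hU.2) (by grind)
    omega
  · exact zero U hU hUne htU

/-- A dictator on `W` dictates all losing sets. -/
theorem value_of_mem_inside (hT : IsGame T) (hW : IsMinWin T W) (hh : OneInThree T h)
    {t : α} (ht : t ∈ W) (hv : ∀ U, U ⊂ W → U.Nonempty → h U = if t ∈ U then 1 else 0)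
    {S : Finset α} (hS : S ∉ T) (htS : t ∈ S) : h S = 1 := by
  have hWS : ¬ W ⊆ S := fun h => hS (hT.up _ _ hW.win h)
  have hUs : S ∩ W ⊂ W := ⟨Finset.inter_subset_right, fun h => hWS (h.trans Finset.inter_subset_left)⟩
  have hUD : S ∩ W ∪ S \ W = S := by grind
  have hD : S \ W ⊆ Wᶜ := by intro x; grind [Finset.mem_compl]
  have hDl : S \ W ∉ T := hT.lose_of_subset hS Finset.sdiff_subset
  -- If `{u} ∪ S \ W` loses, then `W \ {u}`, which contains `t`, takes the value 1 and leaves 0 to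
  -- `Wᶜ \ (S \ W)`.
  by_cases hex : ∃ u ∈ W, u ≠ t ∧ {u} ∪ S \ W ∉ T
  · obtain ⟨u, hu, hut, hl⟩ := hex
    have e1 := hW.rule_trace hT hh (U := {u}) ⟨by simpa, fun h => by
      have := h ht; grind⟩ (by simp) hD hl
    have e2 := hv (W \ {u}) ⟨Finset.sdiff_subset, fun h => by have := h hu; grind⟩ ⟨t, by grind⟩
    have e3 := hW.rule_trace hT hh hUs ⟨t, by grind⟩ hD (by rwa [hUD])
    have e4 := hv (W \ (S ∩ W)) ⟨Finset.sdiff_subset, fun h => by have := h ht; grind⟩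
      (Finset.sdiff_nonempty.2 hUs.2)
    rw [if_pos (by grind)] at e2
    rw [if_neg (by grind)] at e4
    rw [hUD] at e3
    omega
  -- Now every element of `W` other than `t` completes `S \ W` to a winning set, so `S` meets `W` at
  -- most in `t`.
  · push Not at hex
    obtain ⟨u, hu, hut⟩ := hW.exists_ne t
    obtain ⟨v, hvW, hvt, hvu⟩ := hW.exists_ne_ne t u
    have h1 := hex v hvW hvt
    have hSt : ∀ x ∈ S, x ∈ W → x = t := by
      intro x hx hxW
      by_contra hne
      exact hS (hT.up _ _ (hex x hxW hne) (by grind))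
    have hlE : {u} ∪ (Wᶜ \ S) ∉ T :=
      hT.lose_of_disjoint h1 (by intro x; grind [Finset.mem_compl])
    have hs2 : W \ {t, u} ⊂ W := ⟨Finset.sdiff_subset, fun h => by have := h hu; grind⟩
    have e1 : h S + h ({u} ∪ (Wᶜ \ S)) + h (W \ {t, u}) = 1 := by
      refine hh _ _ _ ?_ hS hlE (hW.lose_ssubset hs2)
      intro x; have := hSt x; grind [Finset.mem_compl]
    have e2 := hW.rule_trace hT hh (U := {u}) (D := Wᶜ \ S) ⟨by simpa, fun h => by
      have := h ht; grind⟩ (by simp) Finset.sdiff_subset hlE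
    have e3 := hv (W \ {u}) ⟨Finset.sdiff_subset, fun h => by have := h hu; grind⟩ ⟨t, by grind⟩
    have e4 := hv (W \ {t, u}) hs2 ⟨v, by grind⟩
    rw [if_pos (by grind)] at e3
    rw [if_neg (by grind)] at e4
    omega

/-! ### The complement of `W` has value `1` -/

theorem value_inside_eq_zero (hT : IsGame T) (hW : IsMinWin T W) (hh : OneInThree T h)
    (hC : h Wᶜ = 1) {U : Finset α} (hU : U ⊂ W) (hne : U.Nonempty) : h U = 0 := by
  have := hW.rule_bipartition hT hh hU hne
  omega

theorem singleton_ssubset (hW : IsMinWin T W) {u : α} (hu : u ∈ W) : {u} ⊂ W :=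
  ⟨by simpa, fun h => by
    obtain ⟨v, hv, hvu⟩ := hW.exists_ne u
    have := h hv
    grind⟩

theorem sdiff_singleton_ssubset {u : α} (hu : u ∈ W) : W \ {u} ⊂ W :=
  ⟨Finset.sdiff_subset, fun h => by have := h hu; grind⟩

theorem sdiff_singleton_nonempty (hW : IsMinWin T W) (u : α) : (W \ {u}).Nonempty := by
  obtain ⟨v, hv, hvu⟩ := hW.exists_ne u
  exact ⟨v, by grind⟩

/-- Two different outside elements cannot both turn the complement of `W` into a set of
value `0`. -/
theorem eq_of_value_compl_sdiff (hT : IsGame T) (hW : IsMinWin T W) (hh : OneInThree T h)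
    (hC : h Wᶜ = 1) {c d : α} (hc : c ∉ W) (hd : d ∉ W) (h0 : h (Wᶜ \ {c}) = 0)
    (h1 : h (Wᶜ \ {d}) = 0) : c = d := by
  by_contra hcd
  obtain ⟨A, hA, c1, c2⟩ := hW.exists_pair
  have hA' : A.Nonempty := Finset.card_pos.1 (by omega)
  have hB' : (W \ A).Nonempty := Finset.card_pos.1 (by omega)
  have e0 : W \ (W \ A) = A := Finset.sdiff_sdiff_eq_self hA
  have hAs : A ⊂ W := ⟨hA, Finset.sdiff_nonempty.1 hB'⟩
  have hBs : W \ A ⊂ W := ⟨Finset.sdiff_subset, by rw [← Finset.sdiff_nonempty, e0]; exact hA'⟩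
  have e1 := hW.rule_insert hT hh hA hA' c2 hc
  have e2 := hW.rule_insert hT hh (U := W \ A) Finset.sdiff_subset hB' (by rwa [e0]) hd
  have e3 := hW.value_inside_eq_zero hT hh hC hAs hA'
  have e4 := hW.value_inside_eq_zero hT hh hC hBs hB'
  have e5 : h (insert c A) + h (insert d (W \ A)) + h (Wᶜ \ {c, d}) = 1 := by
    refine hh _ _ _ ?_ (hW.lose_insert c hA c2)
      (hW.lose_insert d Finset.sdiff_subset (by rwa [e0]))
      (hT.lose_of_disjoint hW.win (by grind))
    intro x; have := @hA x; grind [Finset.mem_compl]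
  rw [e0] at e2
  omega

/-- The set `{u, d} ∪ D` together with one more element `v` of `W`. -/
theorem rule_pivot (hT : IsGame T) (hW : IsMinWin T W) (hh : OneInThree T h)
    {u v d : α} {D : Finset α} (hu : u ∈ W) (hv : v ∈ W) (huv : v ≠ u) (hD : D ⊆ Wᶜ)
    (hd : d ∉ W) (hdD : d ∉ D) (hl : {u} ∪ insert d D ∉ T)
    (hw : {u, v} ∪ insert d D ∈ T) :
    h ({u} ∪ insert d D) + h {v} + h (W \ {u, v} ∪ (Wᶜ \ insert d D)) = 1 ∧
    h ({u} ∪ D) + h {v, d} + h (W \ {u, v} ∪ (Wᶜ \ insert d D)) = 1 := by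
  have h1 : W \ {u, v} ∪ (Wᶜ \ insert d D) ∉ T :=
    hT.lose_of_disjoint hw (by intro x; grind [Finset.mem_compl])
  have h2 : {v, d} ∉ T := by
    have := hW.lose_insert (U := {v}) d (by simpa) (hW.two_le_sdiff_singleton v)
    rwa [Finset.pair_comm]
  refine ⟨hh _ _ _ ?_ hl (hW.lose_ssubset (hW.singleton_ssubset hv)) h1,
    hh _ _ _ ?_ (hT.lose_of_subset hl (by grind)) h2 h1⟩
  all_goals intro x; have := @hD x; grind [Finset.mem_compl]

/-- The set `{u, v} ∪ D` and the passage of `d` from the complement to the rest of `W`. -/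
theorem rule_nonpivot (hT : IsGame T) (hW : IsMinWin T W) (hh : OneInThree T h)
    {u v d : α} {D : Finset α} (hu : u ∈ W) (hv : v ∈ W) (huv : v ≠ u) (hD : D ⊆ Wᶜ)
    (hd : d ∉ W) (hdD : d ∉ D) (hl : {u, v} ∪ insert d D ∉ T) :
    h ({u, v} ∪ D) + h (insert d (W \ {u, v})) + h (Wᶜ \ insert d D) = 1 := by
  refine hh _ _ _ ?_ (hT.lose_of_subset hl (by grind))
    (hW.lose_insert d Finset.sdiff_subset ?_) (hT.lose_of_disjoint hW.win (by grind))
  · intro x; have := @hD x; grind [Finset.mem_compl]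
  · rw [Finset.sdiff_sdiff_eq_self (by grind), Finset.card_pair huv.symm]

theorem pair_ssubset (hW : IsMinWin T W) {u v : α} (hu : u ∈ W) (hv : v ∈ W) : {u, v} ⊂ W :=
  ⟨by grind, fun h => by
    obtain ⟨w, hw, h1, h2⟩ := hW.exists_ne_ne u v
    have := h hw
    grind⟩

theorem sdiff_pair_ssubset {u v : α} (hu : u ∈ W) : W \ {u, v} ⊂ W :=
  ⟨Finset.sdiff_subset, fun h => by have := h hu; grind⟩

theorem sdiff_pair_nonempty (hW : IsMinWin T W) (u v : α) : (W \ {u, v}).Nonempty := by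
  obtain ⟨w, hw, h1, h2⟩ := hW.exists_ne_ne u v
  exact ⟨w, by grind⟩

/-- A set of value `1` that meets `W` contains the dictating variable. -/
theorem exists_mem_value_compl_sdiff_of_singleton (hT : IsGame T) (hW : IsMinWin T W)
    (hh : OneInThree T h) (hC : h Wᶜ = 1) {u : α} (hu : u ∈ W) {D : Finset α} (hD : D ⊆ Wᶜ)
    (hl : {u} ∪ D ∉ T) (h1 : h ({u} ∪ D) = 1) : ∃ d ∈ D, h (Wᶜ \ {d}) = 0 := by
  have hus := hW.singleton_ssubset hu
  induction D using Finset.induction_on with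
  | empty =>
    have := hW.value_inside_eq_zero hT hh hC hus (by simp)
    simp_all
  | insert d F hdF ih =>
    have hF : F ⊆ Wᶜ := by grind
    have hdW : d ∉ W := by grind [Finset.mem_compl]
    have hlF : {u} ∪ F ∉ T := hT.lose_of_subset hl (by grind)
    by_cases hF1 : h ({u} ∪ F) = 1
    · obtain ⟨x, hx, hx0⟩ := ih hF hlF hF1
      exact ⟨x, by grind, hx0⟩
    -- Adding `d` is what raises the value from 0 to 1.
    refine ⟨d, by simp, ?_⟩
    have eF := hW.rule_trace hT hh hus (by simp) hF hlF
    have eD := hW.rule_trace hT hh hus (by simp) hD hl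
    obtain ⟨v, hv, hvu⟩ := hW.exists_ne u
    by_cases hw : {u, v} ∪ insert d F ∈ T
    -- Both tripartitions share their third part, of value 0; passing `d` to `{v}` therefore gives
    -- `{v, d}` value 1.
    · obtain ⟨e1, e2⟩ := hW.rule_pivot hT hh hu hv hvu hF hdW hdF hl hw
      have e3 := hW.rule_insert hT hh (U := {v}) (by simpa) (by simp)
        (hW.two_le_sdiff_singleton v) hdW
      rw [Finset.pair_comm] at e3
      omega
    -- Here `Wᶜ \ F` has value 1 and `Wᶜ \ insert d F` value 0, so `d` raises `W \ {u, v}` to value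
    -- 1.
    · have e1 := hW.rule_nonpivot hT hh hu hv hvu hF hdW hdF hw
      have e2 := hW.rule_trace hT hh (hW.pair_ssubset hu hv) (by simp) hF
        (hT.lose_of_subset hw (by grind))
      have e3 := hW.rule_insert hT hh (U := W \ {u, v}) Finset.sdiff_subset
        (hW.sdiff_pair_nonempty u v)
        (by rw [Finset.sdiff_sdiff_eq_self (by grind), Finset.card_pair hvu.symm]) hdW
      have e4 := hW.value_inside_eq_zero hT hh hC (sdiff_pair_ssubset (v := v) hu)
        (hW.sdiff_pair_nonempty u v)
      have e5 := hW.value_inside_eq_zero hT hh hC (hW.pair_ssubset hu hv) (by simp)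
      rw [Finset.sdiff_sdiff_eq_self (by grind)] at e3
      omega

theorem exists_mem_value_compl_sdiff (hT : IsGame T) (hW : IsMinWin T W)
    (hh : OneInThree T h) (hC : h Wᶜ = 1) {u : α} (hu : u ∈ W) {S : Finset α} (hS : S ∉ T)
    (huS : u ∈ S) (h1 : h S = 1) : ∃ d ∈ S, d ∉ W ∧ h (Wᶜ \ {d}) = 0 := by
  have hD : S \ W ⊆ Wᶜ := by intro x; grind [Finset.mem_compl]
  have hUD : S ∩ W ∪ S \ W = S := by grind
  have hl : {u} ∪ S \ W ∉ T := hT.lose_of_subset hS (by grind)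
  have hs : S ∩ W ⊂ W := ⟨Finset.inter_subset_right, fun h =>
    hS (hT.up _ _ hW.win (h.trans Finset.inter_subset_left))⟩
  have e1 := hW.rule_trace hT hh hs ⟨u, by grind⟩ hD (by rwa [hUD])
  have e2 := hW.rule_trace hT hh (hW.singleton_ssubset hu) (by simp) hD hl
  have e3 := hW.value_inside_eq_zero hT hh hC (sdiff_singleton_ssubset hu)
    (hW.sdiff_singleton_nonempty u)
  rw [hUD] at e1
  obtain ⟨d, hd, h0⟩ := hW.exists_mem_value_compl_sdiff_of_singleton hT hh hC hu hD hl (by omega)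
  exact ⟨d, by grind, by grind, h0⟩

/-- Otherwise no losing set meeting `W` has value 1, but a pivot over `{u}` yields a losing
tripartition whose parts contain `u`, `v` and `w`. -/
theorem exists_value_compl_sdiff (hT : IsGame T) (hW : IsMinWin T W)
    (hh : OneInThree T h) (hC : h Wᶜ = 1) : ∃ d, d ∉ W ∧ h (Wᶜ \ {d}) = 0 := by
  by_contra! hno
  have key : ∀ S, S ∉ T → ∀ u ∈ W, u ∈ S → h S ≠ 1 := fun S hS u hu huS h1 => by
    obtain ⟨d, -, hd, h0⟩ := hW.exists_mem_value_compl_sdiff hT hh hC hu hS huS h1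
    exact hno d hd h0
  obtain ⟨u, hu⟩ : W.Nonempty := Finset.card_pos.1 (by have := hW.four; omega)
  obtain ⟨v, hv, hvu⟩ := hW.exists_ne u
  obtain ⟨w, hw, hwu, hwv⟩ := hW.exists_ne_ne u v
  obtain ⟨D, e, hD, he, heD, hl, hwin⟩ := exists_pivot (T := T) (X := {u}) (C := Wᶜ)
    (hW.lose_ssubset (hW.singleton_ssubset hu))
    (hT.win_of_cover (hW.lose_ssubset (sdiff_singleton_ssubset hu))
      (by intro x; grind [Finset.mem_compl]))
  have heW : e ∉ W := by grind [Finset.mem_compl]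
  have h2 : {v, e} ∉ T := by
    have := hW.lose_insert (U := {v}) e (by simpa) (hW.two_le_sdiff_singleton v)
    rwa [Finset.pair_comm]
  have h3 : W \ {u, v} ∪ (Wᶜ \ insert e D) ∉ T :=
    hT.lose_of_disjoint hwin (by intro x; grind [Finset.mem_compl])
  have e1 : h ({u} ∪ D) + h {v, e} + h (W \ {u, v} ∪ (Wᶜ \ insert e D)) = 1 := by
    refine hh _ _ _ ?_ hl h2 h3
    intro x; have := @hD x; grind [Finset.mem_compl]
  have k1 := key _ hl u hu (by simp)
  have k2 := key _ h2 v hv (by simp)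
  have k3 := key _ h3 w hw (by grind)
  omega

/-- A converse to `exists_mem_value_compl_sdiff`: the same two tripartition rules, applied to `t`,
show that `Wᶜ \ (S \ W)` has value 0. -/
theorem value_of_mem_outside (hT : IsGame T) (hW : IsMinWin T W) (hh : OneInThree T h)
    (hC : h Wᶜ = 1) {t u : α} (ht : t ∉ W) (ht0 : h (Wᶜ \ {t}) = 0) (hu : u ∈ W)
    {S : Finset α} (hS : S ∉ T) (huS : u ∈ S) (htS : t ∈ S) : h S = 1 := by
  have hD : S \ W ⊆ Wᶜ := by intro x; grind [Finset.mem_compl]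
  have hF : (S \ W).erase t ⊆ Wᶜ := by intro x; grind [Finset.mem_compl]
  have hDt : insert t ((S \ W).erase t) = S \ W := Finset.insert_erase (by grind)
  have hUD : S ∩ W ∪ S \ W = S := by grind
  have hl : {u} ∪ S \ W ∉ T := hT.lose_of_subset hS (by grind)
  have hs : S ∩ W ⊂ W := ⟨Finset.inter_subset_right, fun h =>
    hS (hT.up _ _ hW.win (h.trans Finset.inter_subset_left))⟩
  have e1 := hW.rule_trace hT hh hs ⟨u, by grind⟩ hD (by rwa [hUD])
  have e2 := hW.rule_trace hT hh (hW.singleton_ssubset hu) (by simp) hD hl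
  have e3 := hW.value_inside_eq_zero hT hh hC (sdiff_singleton_ssubset hu)
    (hW.sdiff_singleton_nonempty u)
  have e4 := hW.value_inside_eq_zero hT hh hC (U := W \ (S ∩ W))
    ⟨Finset.sdiff_subset, fun h => by have := h hu; grind⟩ (Finset.sdiff_nonempty.2 hs.2)
  rw [hUD] at e1
  obtain ⟨v, hv, hvu⟩ := hW.exists_ne u
  suffices h (Wᶜ \ (S \ W)) = 0 by omega
  by_cases hw : {u, v} ∪ S \ W ∈ T
  · obtain ⟨e5, e6⟩ := hW.rule_pivot hT hh hu hv hvu hF ht (by simp) (by rwa [hDt]) (by rwa [hDt])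
    have e7 := hW.rule_insert hT hh (U := {v}) (by simpa) (by simp)
      (hW.two_le_sdiff_singleton v) ht
    have e8 := hW.value_inside_eq_zero hT hh hC (sdiff_singleton_ssubset hv)
      (hW.sdiff_singleton_nonempty v)
    have e9 := hW.value_inside_eq_zero hT hh hC (hW.singleton_ssubset hv) (by simp)
    rw [Finset.pair_comm] at e7
    rw [hDt] at e5 e6
    omega
  · have e5 := hW.rule_nonpivot hT hh hu hv hvu hF ht (by simp) (by rwa [hDt])
    have e6 := hW.rule_insert hT hh (U := W \ {u, v}) Finset.sdiff_subset
      (hW.sdiff_pair_nonempty u v)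
      (by rw [Finset.sdiff_sdiff_eq_self (by grind), Finset.card_pair hvu.symm]) ht
    have e7 := hW.value_inside_eq_zero hT hh hC (hW.pair_ssubset hu hv) (by simp)
    rw [Finset.sdiff_sdiff_eq_self (by grind)] at e6
    rw [hDt] at e5
    omega

/-- If the part with `t` misses `W`, both other parts meet `W`, since neither can contain it.
Lacking `t`, they do not have value 1. -/
theorem dictates_outside (hT : IsGame T) (hW : IsMinWin T W) (hh : OneInThree T h)
    (hC : h Wᶜ = 1) {t : α} (ht : t ∉ W) (ht0 : h (Wᶜ \ {t}) = 0) : Dictates T h t := by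
  intro X Y Z hP hX hY hZ htX
  have eq : ∀ S, S ∉ T → (∃ u ∈ W, u ∈ S) → h S = 1 → t ∈ S := by
    rintro S hS ⟨u, hu, huS⟩ h1
    obtain ⟨d, hdS, hd, h0⟩ := hW.exists_mem_value_compl_sdiff hT hh hC hu hS huS h1
    rwa [hW.eq_of_value_compl_sdiff hT hh hC ht hd ht0 h0]
  have htP := hP t
  by_cases hXW : ∃ u ∈ W, u ∈ X
  · obtain ⟨u, hu, huX⟩ := hXW
    exact hW.value_of_mem_outside hT hh hC ht ht0 hu hX huX htX
  · push Not at hXW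
    have meets : ∀ A B, Tripartition X A B → B ∉ T → ∃ u ∈ W, u ∈ A := by
      intro A B hP hB
      by_contra! hA
      exact hB (hT.up _ _ hW.win fun x hx => by
        have := hP x; have := hXW x hx; have := hA x hx; grind)
    have hY' := eq Y hY (meets Y Z hP hZ)
    have hZ' := eq Z hZ (meets Z Y (fun a => by have := hP a; grind) hY)
    have := hh X Y Z hP hX hY hZ
    grind

end IsMinWin

/-- A game without small winning sets whose losing tripartitions follow the one-in-three rule
has a dictator. -/
theorem IsGame.exists_dictates (hT : IsGame T) (hsmall : ∀ X ∈ T, 4 ≤ X.card)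
    (hh : OneInThree T h) : ∃ t, Dictates T h t := by
  have hne : T.Nonempty := by
    by_contra he
    rw [Finset.not_nonempty_iff_eq_empty] at he
    simpa [he] using hT.compl ∅
  obtain ⟨W, hWT, hle⟩ := T.exists_min_image Finset.card hne
  have hW : IsMinWin T W := ⟨hWT, hsmall W hWT, hle⟩
  by_cases hC : h Wᶜ = 0
  · obtain ⟨t, ht, hv⟩ := hW.exists_dictator_inside hT hh hC
    exact ⟨t, fun X Y Z _ hX _ _ htX => hW.value_of_mem_inside hT hh ht hv hX htX⟩
  · obtain ⟨u, hu⟩ : W.Nonempty := Finset.card_pos.1 (by have := hW.four; omega)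
    have e := hW.rule_bipartition hT hh (hW.singleton_ssubset hu) (by simp)
    have hC1 : h Wᶜ = 1 := by omega
    obtain ⟨t, ht, ht0⟩ := hW.exists_value_compl_sdiff hT hh hC1
    exact ⟨t, hW.dictates_outside hT hh hC1 ht ht0⟩

/-! ### Different games with the same values have the same dictator -/

/-- Any two elements are separated by a losing tripartition in which the complement of a given
minimal winning set does not occur. -/
theorem IsGame.exists_separating (hT : IsGame T) (hsmall : ∀ X ∈ T, 4 ≤ X.card)
    {X : Finset α} (hX : X ∈ T) (hmin : ∀ U, U ⊂ X → U ∉ T) {t s : α} (hts : t ≠ s) :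
    ∃ P Q R, Tripartition P Q R ∧ P ∉ T ∧ Q ∉ T ∧ R ∉ T ∧ P ≠ Xᶜ ∧ Q ≠ Xᶜ ∧ R ≠ Xᶜ ∧
      t ∈ P ∧ s ∈ Q := by
  have hX4 := hsmall X hX
  have step : ∀ u ∈ X, ∀ d, d ∉ X → ∃ P Q R : Finset α, P = {u, d} ∧ Q = X \ {u} ∧
      R = Xᶜ \ {d} ∧ Tripartition P Q R ∧ P ∉ T ∧ Q ∉ T ∧ R ∉ T ∧ P ≠ Xᶜ ∧ Q ≠ Xᶜ ∧ R ≠ Xᶜ := by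
    intro u hu d hd
    obtain ⟨v, hv, hvu⟩ := Finset.exists_mem_ne (s := X) (by omega) u
    refine ⟨_, _, _, rfl, rfl, rfl, fun a => by grind [Finset.mem_compl], fun h => ?_,
      hmin _ ⟨Finset.sdiff_subset, fun h => by have := h hu; grind⟩,
      hT.lose_of_disjoint hX (by grind), fun h => ?_, fun h => ?_, fun h => ?_⟩
    · have := hsmall _ h
      have := Finset.card_le_two (a := u) (b := d)
      omega
    · have : u ∈ Xᶜ := by rw [← h]; simp
      grind [Finset.mem_compl]
    · have : v ∈ Xᶜ := by rw [← h]; grind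
      grind [Finset.mem_compl]
    · have : d ∈ Xᶜ \ {d} := by rw [h]; simpa
      grind
  obtain ⟨u₀, hu₀⟩ : X.Nonempty := Finset.card_pos.1 (by omega)
  -- By minimality `X \ {u₀}` loses, so its complement `insert u₀ Xᶜ` wins and has at least four
  -- elements.
  have hXc : 2 ≤ Xᶜ.card := by
    have h1 := hmin (X \ {u₀}) ⟨Finset.sdiff_subset, fun h => by have := h hu₀; grind⟩
    have h2 := hsmall (insert u₀ Xᶜ)
      (hT.win_of_cover h1 (by intro x; grind [Finset.mem_compl]))
    have := Finset.card_insert_le u₀ Xᶜ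
    omega
  have hd : ∀ x, ∃ d, d ∉ X ∧ d ≠ x := fun x => by
    obtain ⟨d, hd, hdx⟩ := Finset.exists_mem_ne (s := Xᶜ) (by omega) x
    exact ⟨d, by simpa using hd, hdx⟩
  have hu : ∀ x, ∃ u ∈ X, u ≠ x := fun x => Finset.exists_mem_ne (by omega) x
  by_cases ht : t ∈ X <;> by_cases hs : s ∈ X
  · obtain ⟨d, hd, -⟩ := hd t
    obtain ⟨P, Q, R, rfl, rfl, rfl, h1, h2, h3, h4, h5, h6, h7⟩ := step t ht d hd
    exact ⟨_, _, _, h1, h2, h3, h4, h5, h6, h7, by grind, by grind⟩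
  · obtain ⟨d, hd, hds⟩ := hd s
    obtain ⟨P, Q, R, rfl, rfl, rfl, h1, h2, h3, h4, h5, h6, h7⟩ := step t ht d hd
    exact ⟨_, _, _, fun a => by have := h1 a; grind, h2, h4, h3, h5, h7, h6, by grind,
      by grind [Finset.mem_compl]⟩
  · obtain ⟨d, hd, hdt⟩ := hd t
    obtain ⟨P, Q, R, rfl, rfl, rfl, h1, h2, h3, h4, h5, h6, h7⟩ := step s hs d hd
    exact ⟨_, _, _, fun a => by have := h1 a; grind, h4, h2, h3, h7, h5, h6,
      by grind [Finset.mem_compl], by grind⟩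
  · obtain ⟨u, hu, -⟩ := hu t
    obtain ⟨P, Q, R, rfl, rfl, rfl, h1, h2, h3, h4, h5, h6, h7⟩ := step u hu t ht
    exact ⟨_, _, _, fun a => by have := h1 a; grind, h2, h4, h3, h5, h7, h6, by grind,
      by grind [Finset.mem_compl]⟩

theorem exists_minimal_winning {X : Finset α} (hX : X ∈ T) :
    ∃ Y ⊆ X, Y ∈ T ∧ ∀ U, U ⊂ Y → U ∉ T := by
  induction X using Finset.strongInduction with
  | H X ih =>
    by_cases h : ∃ U, U ⊂ X ∧ U ∈ T
    · obtain ⟨U, hU, hUT⟩ := h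
      obtain ⟨Y, hY, h1⟩ := ih U hU hUT
      exact ⟨Y, hY.trans hU.1, h1⟩
    · push Not at h
      exact ⟨X, subset_rfl, hX, h⟩

/-- Exchanging a minimal winning set and its complement. -/
theorem IsGame.swap (hT : IsGame T) {X : Finset α} (hX : X ∈ T) (hmin : ∀ U, U ⊂ X → U ∉ T)
    (hne : Xᶜ.Nonempty) : IsGame (insert Xᶜ (T.erase X)) := by
  obtain ⟨x, hx⟩ := hne
  have hXX : X ≠ Xᶜ := fun h => by rw [← h] at hx; grind [Finset.mem_compl]
  constructor
  · intro Y Z hY hYZ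
    rw [Finset.mem_insert, Finset.mem_erase] at hY ⊢
    by_cases hZ : Z = Xᶜ
    · exact Or.inl hZ
    right
    rcases hY with rfl | ⟨hYX, hY⟩
    · refine ⟨?_, ?_⟩
      · rintro rfl
        have := hYZ hx
        grind [Finset.mem_compl]
      -- The complement of `Z` is a proper subset of `X`, hence losing.
      · rw [hT.compl]
        refine hmin _ ⟨by intro a; have := @hYZ a; grind [Finset.mem_compl], fun h => hZ ?_⟩
        ext a
        have := @hYZ a
        have := @h a
        grind [Finset.mem_compl]
    · refine ⟨?_, hT.up _ _ hY hYZ⟩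
      rintro rfl
      exact hmin Y (lt_of_le_of_ne hYZ hYX) hY
  · intro Y
    simp only [Finset.mem_insert, Finset.mem_erase, compl_inj_iff]
    have h1 := hT.compl Y
    have h2 := hT.compl X
    have h3 : Yᶜ = X ↔ Y = Xᶜ := by rw [compl_eq_comm, eq_comm]
    by_cases hY : Y = X
    · subst hY; simp [hXX]
    · by_cases hY' : Y = Xᶜ
      · subst hY'
        simp [hXX.symm]
      · simp [hY, hY', h3, h1]

/-- Each dictator gives its own part value 1, and a tripartition has room for only one. -/
theorem Dictates.eq_of_separated {t s : α} (ht : Dictates T h t) {T' : Finset (Finset α)}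
    (hs : Dictates T' h s) (hh : OneInThree T h) {P Q R : Finset α} (hP : Tripartition P Q R)
    (h1 : P ∉ T) (h2 : Q ∉ T) (h3 : R ∉ T) (h1' : P ∉ T') (h2' : Q ∉ T') (h3' : R ∉ T')
    (htP : t ∈ P) (hsQ : s ∈ Q) : False := by
  have e1 := ht P Q R hP h1 h2 h3 htP
  have e2 := hs Q P R (fun a => by have := hP a; grind) h2' h1' h3' hsQ
  have e3 := hh P Q R hP h1 h2 h3
  omega

theorem OneInThree.mono (hh : OneInThree F h) (hFT : F ⊆ T) : OneInThree T h :=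
  fun X Y Z hP hX hY hZ => hh X Y Z hP (fun h => hX (hFT h)) (fun h => hY (hFT h))
    (fun h => hZ (hFT h))

/-- The dictator is the same for all games that contain `F`. -/
theorem Dictates.eq (hh : OneInThree F h) {T' : Finset (Finset α)} (hT' : IsGame T')
    (hsmall' : ∀ X ∈ T', 4 ≤ X.card) (hF' : F ⊆ T') {s : α} (hs : Dictates T' h s)
    (hT : IsGame T) (hsmall : ∀ X ∈ T, 4 ≤ X.card) (hF : F ⊆ T) {t : α} (ht : Dictates T h t) :
    t = s := by
  induction hm : (T \ T').card using Nat.strong_induction_on generalizing T t with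
  | _ m ih =>
    subst hm
    by_cases hsub : T ⊆ T'
    · have : T = T' := by
        refine Finset.Subset.antisymm hsub fun X hX => ?_
        by_contra hXT
        have h1 := (hT'.compl X).1 hX
        exact h1 (hsub (by by_contra h2; exact hXT ((hT.compl X).2 h2)))
      subst this
      by_contra hts
      have hwin : Finset.univ ∈ T := hT.win_of_cover (Y := ∅)
        (fun h => by have := hsmall _ h; simp at this) (by simp)
      obtain ⟨X, -, hX, hmin⟩ := exists_minimal_winning hwin
      obtain ⟨P, Q, R, hP, h1, h2, h3, -, -, -, htP, hsQ⟩ :=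
        hT.exists_separating hsmall hX hmin hts
      exact ht.eq_of_separated hs (hh.mono hF) hP h1 h2 h3 h1 h2 h3 htP hsQ
    · obtain ⟨X', hX'T, hX'⟩ := Finset.not_subset.1 hsub
      obtain ⟨X, hXX, hX, hmin⟩ := exists_minimal_winning hX'T
      have hXT' : X ∉ T' := hT'.lose_of_subset hX' hXX
      have hXc : Xᶜ ∈ T' := hT'.win_of_cover hXT' subset_rfl
      have hXc4 := hsmall' _ hXc
      -- Since `X ∉ T'` and `Xᶜ ∈ T'`, the exchange brings the game closer to `T'`, keeps `F`, and
      -- creates no small winning set.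
      have hG := hT.swap hX hmin (Finset.card_pos.1 (by omega))
      have hGs : ∀ Y ∈ insert Xᶜ (T.erase X), 4 ≤ Y.card := by
        intro Y hY
        rcases Finset.mem_insert.1 hY with rfl | hY
        · exact hXc4
        · exact hsmall Y (Finset.mem_of_mem_erase hY)
      have hGF : F ⊆ insert Xᶜ (T.erase X) := fun Y hY =>
        Finset.mem_insert_of_mem (Finset.mem_erase.2 ⟨fun h => hXT' (h ▸ hF' hY), hF hY⟩)
      obtain ⟨r, hr⟩ := hG.exists_dictates hGs (hh.mono hGF)
      have hrs : r = s := by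
        refine ih _ (Finset.card_lt_card ⟨fun Y hY => ?_, fun h => ?_⟩) hG hGs hGF hr rfl
        · grind
        · have := h (Finset.mem_sdiff.2 ⟨hX, hXT'⟩)
          grind
      rw [← hrs]
      by_contra htr
      -- No part is `Xᶜ`, so all parts lose in both games.
      obtain ⟨P, Q, R, hP, h1, h2, h3, h4, h5, h6, htP, hrQ⟩ :=
        hT.exists_separating hsmall hX hmin htr
      exact ht.eq_of_separated hr (hh.mono hF) hP h1 h2 h3 (by grind) (by grind) (by grind)
        htP hrQ

end Games

/-! ### Values of small sets in arity at most six -/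

section SmallArity

variable {α : Type*} [DecidableEq α] [Fintype α]

/-- The affine formula for the values of small sets on a ground set with six elements. -/
theorem value_add_card_mul {h : Finset α → ℕ} (hcard : Fintype.card α = 6)
    (hh : ∀ X Y Z : Finset α, Tripartition X Y Z → X.card ≤ 3 → Y.card ≤ 3 → Z.card ≤ 3 →
      h X + h Y + h Z = 1) {S : Finset α} (hS : S.card ≤ 3) :
    h S + S.card * h ∅ = h ∅ + ∑ a ∈ S, h {a} := by
  have three : ∀ A B : Finset α, Disjoint A B → A.card + B.card = 3 →
      h (A ∪ B) + h ∅ = h A + h B := by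
    intro A B hAB hc
    have hu := Finset.card_union_of_disjoint hAB
    have hcc : (A ∪ B)ᶜ.card = 3 := by rw [Finset.card_compl]; omega
    rw [Finset.disjoint_left] at hAB
    have e1 := hh A B (A ∪ B)ᶜ (fun a => by have := @hAB a; grind [Finset.mem_compl])
      (by omega) (by omega) (by omega)
    have e2 := hh (A ∪ B) ∅ (A ∪ B)ᶜ (fun a => by grind [Finset.mem_compl])
      (by omega) (by simp) (by omega)
    omega
  -- The other four elements split into two pairs; moving `b` into the pair `P` reduces to `three`.
  have pair : ∀ a b, a ≠ b → h {a, b} + h ∅ = h {a} + h {b} := by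
    intro a b hab
    have hc : ({a, b} : Finset α)ᶜ.card = 4 := by
      rw [Finset.card_compl, Finset.card_pair hab]; omega
    obtain ⟨P, hP, hPc⟩ := Finset.exists_subset_card_eq (s := ({a, b} : Finset α)ᶜ) (n := 2)
      (by omega)
    have hbP : b ∉ P := fun h => by have := hP h; simp at this
    have haP : a ∉ P := fun h => by have := hP h; simp at this
    have hQc := Finset.card_sdiff_add_card_eq_card hP
    have e1 := hh {a, b} P (({a, b} : Finset α)ᶜ \ P)
      (fun x => by have := @hP x; grind [Finset.mem_compl])
      (by rw [Finset.card_pair hab]; omega) (by omega) (by omega)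
    have e2 := hh {a} ({b} ∪ P) (({a, b} : Finset α)ᶜ \ P)
      (fun x => by have := @hP x; grind [Finset.mem_compl]) (by simp)
      (by rw [Finset.card_union_of_disjoint (by simpa)]; simp; omega) (by omega)
    have e3 := three {b} P (by simpa) (by simp; omega)
    omega
  have hcases : S.card = 0 ∨ S.card = 1 ∨ S.card = 2 ∨ S.card = 3 := by omega
  rcases hcases with hc | hc | hc | hc
  · rw [Finset.card_eq_zero] at hc
    simp [hc]
  · obtain ⟨a, rfl⟩ := Finset.card_eq_one.1 hc
    simp; omega
  · obtain ⟨a, b, hab, rfl⟩ := Finset.card_eq_two.1 hc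
    have := pair a b hab
    rw [Finset.card_pair hab, Finset.sum_pair hab]
    omega
  · obtain ⟨a, b, c, hab, hac, hbc, rfl⟩ := Finset.card_eq_three.1 hc
    have e1 := pair b c hbc
    have e2 := three {a} {b, c} (by simp [hab, hac]) (by rw [Finset.card_pair hbc]; simp)
    rw [← Finset.insert_eq] at e2
    rw [hc, Finset.sum_insert (by simp [hab, hac]), Finset.sum_pair hbc]
    omega

theorem exists_dictator_of_card_eq_six {h : Finset α → ℕ} (hcard : Fintype.card α = 6)
    (hh : ∀ X Y Z : Finset α, Tripartition X Y Z → X.card ≤ 3 → Y.card ≤ 3 → Z.card ≤ 3 →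
      h X + h Y + h Z = 1) :
    h ∅ = 0 ∧ ∃ t, ∀ S : Finset α, S.card ≤ 3 → h S = if t ∈ S then 1 else 0 := by
  have key := fun S hS => value_add_card_mul hcard hh (S := S) hS
  obtain ⟨A, -, hA⟩ := Finset.exists_subset_card_eq (s := (Finset.univ : Finset α)) (n := 3)
    (by rw [Finset.card_univ]; omega)
  have hAc : Aᶜ.card = 3 := by rw [Finset.card_compl]; omega
  have hsum : ∑ a, h {a} = 1 + 3 * h ∅ := by
    have e1 := hh A ∅ Aᶜ (fun a => by grind [Finset.mem_compl]) (by omega) (by simp) (by omega)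
    have e2 := key A (by omega)
    have e3 := key Aᶜ (by omega)
    have e4 := Finset.sum_add_sum_compl A (fun a => h {a})
    rw [hA] at e2
    rw [hAc] at e3
    omega
  have h0 : h ∅ = 0 := by
    by_contra hne
    have e1 := hh A ∅ Aᶜ (fun a => by grind [Finset.mem_compl]) (by omega) (by simp) (by omega)
    have hc : h ∅ = 1 := by omega
    -- At most one singleton can have value 0, so the singletons sum to at least 5, while `hsum`
    -- gives 4.
    have hpair : ∀ a b, a ≠ b → 1 ≤ h {a} + h {b} := fun a b hab => by
      have := key {a, b} (by rw [Finset.card_pair hab]; omega)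
      rw [Finset.card_pair hab, Finset.sum_pair hab] at this
      omega
    have hge : ∀ S : Finset α, (∀ a ∈ S, 1 ≤ h {a}) → S.card ≤ ∑ a ∈ S, h {a} := fun S hS => by
      simpa using Finset.card_nsmul_le_sum S (fun a => h {a}) 1 hS
    by_cases hz : ∃ z, h {z} = 0
    · obtain ⟨z, hz⟩ := hz
      have e2 := hge (Finset.univ.erase z) fun a ha => by
        have := hpair a z (Finset.ne_of_mem_erase ha)
        omega
      have e3 := Finset.add_sum_erase Finset.univ (fun a => h {a}) (Finset.mem_univ z)
      rw [Finset.card_erase_of_mem (Finset.mem_univ z), Finset.card_univ] at e2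
      omega
    · push Not at hz
      have e2 := hge Finset.univ fun a _ => by have := hz a; omega
      rw [Finset.card_univ] at e2
      omega
  refine ⟨h0, ?_⟩
  rw [h0] at hsum
  obtain ⟨t, -, ht⟩ := Finset.exists_ne_zero_of_sum_ne_zero (by omega : ∑ a, h {a} ≠ 0)
  refine ⟨t, fun S hS => ?_⟩
  have e1 := Finset.add_sum_erase Finset.univ (fun a => h {a}) (Finset.mem_univ t)
  have e2 := key S hS
  rw [h0] at e2
  have hz : ∀ a, a ≠ t → h {a} = 0 := fun a ha => by
    have := Finset.single_le_sum (f := fun a => h {a}) (fun _ _ => Nat.zero_le _)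
      (Finset.mem_erase.2 ⟨ha, Finset.mem_univ a⟩)
    omega
  split_ifs with htS
  · rw [Finset.sum_eq_single_of_mem t htS fun a _ ha => hz a ha] at e2
    omega
  · rw [Finset.sum_eq_zero fun a ha => hz a (by rintro rfl; exact htS ha)] at e2
    omega

/-- On at most six elements the values of the small sets are those of a projection. -/
theorem exists_dictator_of_le_six {n : ℕ} (hn : n ≤ 6) {h : Finset (Fin n) → ℕ}
    (hh : ∀ X Y Z : Finset (Fin n), Tripartition X Y Z → X.card ≤ 3 → Y.card ≤ 3 → Z.card ≤ 3 →
      h X + h Y + h Z = 1) :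
    ∃ t, ∀ S : Finset (Fin n), S.card ≤ 3 → h S = if t ∈ S then 1 else 0 := by
  -- Preimages under an embedding into six points preserve tripartitions, whose parts may be empty,
  -- and do not increase size.
  let π : Fin n ↪ Fin 6 := Fin.castLEEmb hn
  let pre : Finset (Fin 6) → Finset (Fin n) := fun S => Finset.univ.filter (π · ∈ S)
  have hpre : ∀ S a, a ∈ pre S ↔ π a ∈ S := fun S a => by simp [pre]
  have hcard : ∀ S, (pre S).card ≤ S.card := fun S => by
    rw [← Finset.card_map π]
    refine Finset.card_le_card fun x hx => ?_
    obtain ⟨a, ha, rfl⟩ := Finset.mem_map.1 hx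
    exact (hpre _ _).1 ha
  obtain ⟨h0, t, ht⟩ := exists_dictator_of_card_eq_six (h := fun S => h (pre S))
    (by simp) fun X Y Z hP hX hY hZ => hh _ _ _
      (fun a => by simpa only [hpre] using hP (π a)) ((hcard X).trans hX) ((hcard Y).trans hY)
      ((hcard Z).trans hZ)
  by_cases hr : ∃ a, π a = t
  · obtain ⟨a, rfl⟩ := hr
    refine ⟨a, fun S hS => ?_⟩
    have e := ht (S.map π) (by rwa [Finset.card_map])
    have : pre (S.map π) = S := by ext; simp [hpre]
    simpa [this] using e
  -- Outside the image, `{t}` and `∅` have the same preimage but would need values 1 and 0.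
  · push Not at hr
    have e := ht {t} (by simp)
    have : pre {t} = pre ∅ := by ext a; simp [hpre, hr a]
    simp only [this, Finset.mem_singleton, if_true] at e
    omega

end SmallArity

/-! ### Polymorphisms as set functions -/

variable {n : ℕ} {f g : (Fin n → Fin 2) → Fin 3}

/-- The family of `2`-sets. -/
def twoSets (f : (Fin n → Fin 2) → Fin 3) : Finset (Finset (Fin n)) :=
  Finset.univ.filter fun X => val f X = 2

/-- The indicator of the sets of value `1`. -/
def ind (f : (Fin n → Fin 2) → Fin 3) (X : Finset (Fin n)) : ℕ :=
  if val f X = 1 then 1 else 0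

theorem mem_twoSets {X : Finset (Fin n)} : X ∈ twoSets f ↔ val f X = 2 := by
  simp [twoSets]

theorem tuple_injective : Function.Injective (tuple (n := n)) := by
  intro X Y h
  ext j
  have := congrFun h j
  simp only [tuple] at this
  split_ifs at this <;> simp_all

theorem tuple_support (x : Fin n → Fin 2) : tuple (Finset.univ.filter (x · = 1)) = x := by
  funext j
  simp only [tuple, Finset.mem_filter, Finset.mem_univ, true_and]
  split_ifs with h <;> omega

theorem val_recolour (X Y : Finset (Fin n)) (i : Fin 3) :
    val (recolour f X i) Y = if Y = X then i else val f Y := by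
  simp [val, recolour, Function.update_apply, tuple_injective.eq_iff]

theorem mem_LO_three_iff (v : Fin 3 → Fin 3) :
    v ∈ LO 3 ↔ (v 1 < v 0 ∧ v 2 < v 0) ∨ (v 0 < v 1 ∧ v 2 < v 1) ∨ (v 0 < v 2 ∧ v 1 < v 2) := by
  simp [LO, Fin.exists_fin_succ, Fin.forall_fin_succ]

theorem mem_LO_two_iff (v : Fin 3 → Fin 2) :
    v ∈ LO 2 ↔ (v 0 = 1 ∧ v 1 ≠ 1 ∧ v 2 ≠ 1) ∨ (v 0 ≠ 1 ∧ v 1 = 1 ∧ v 2 ≠ 1) ∨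
      (v 0 ≠ 1 ∧ v 1 ≠ 1 ∧ v 2 = 1) := by
  simp only [LO, Set.mem_ofPred_eq, Fin.exists_fin_succ, Fin.forall_fin_succ]
  simp
  generalize v 0 = a
  generalize v 1 = b
  generalize v 2 = c
  revert a b c
  decide

theorem isLOPol_iff_tripartition : IsLOPol f ↔ ∀ X Y Z, Tripartition X Y Z →
    ![val f X, val f Y, val f Z] ∈ LO 3 := by
  constructor
  · intro hf X Y Z hP
    have := hf ![tuple X, tuple Y, tuple Z] fun j => by
      rw [mem_LO_two_iff]
      simpa [tuple] using hP j
    convert this using 1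
    funext i
    fin_cases i <;> rfl
  · intro hf M hM
    have := hf (Finset.univ.filter (M 0 · = 1)) (Finset.univ.filter (M 1 · = 1))
      (Finset.univ.filter (M 2 · = 1)) fun j => by
        simpa using (mem_LO_two_iff _).1 (hM j)
    convert this using 1
    funext i
    fin_cases i <;> simp [val, tuple_support]

/-- A map is a polymorphism if its `2`-sets intersect and the tripartitions into boolean sets
follow the one-in-three rule. -/
theorem isLOPol_iff : IsLOPol f ↔
    (∀ X ∈ twoSets f, ∀ Y ∈ twoSets f, ¬ Disjoint X Y) ∧ OneInThree (twoSets f) (ind f) := by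
  rw [isLOPol_iff_tripartition]
  -- Without a 2, a unique maximum means exactly one 1; with a 2, it suffices that no other entry is
  -- 2.
  have bool : ∀ a b c : Fin 3, a ≠ 2 → b ≠ 2 → c ≠ 2 →
      (((b < a ∧ c < a) ∨ (a < b ∧ c < b) ∨ (a < c ∧ b < c)) ↔
      ((if a = 1 then 1 else 0) + (if b = 1 then 1 else 0) + (if c = 1 then 1 else 0) : ℕ) = 1) := by
    decide
  have two : ∀ a b c : Fin 3, (a = 2 ∨ b = 2 ∨ c = 2) → (a = 2 → b = 2 → False) →
      (a = 2 → c = 2 → False) → (b = 2 → c = 2 → False) →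
      ((b < a ∧ c < a) ∨ (a < b ∧ c < b) ∨ (a < c ∧ b < c)) := by
    decide
  constructor
  · intro hf
    refine ⟨fun X hX Y hY hXY => ?_, fun X Y Z hP hX hY hZ => ?_⟩
    · rw [Finset.disjoint_left] at hXY
      have := hf X Y (X ∪ Y)ᶜ fun a => by have := @hXY a; grind [Finset.mem_compl]
      rw [mem_LO_three_iff] at this
      rw [mem_twoSets] at hX hY
      simp [hX, hY] at this
      omega
    · have := hf X Y Z hP
      rw [mem_LO_three_iff] at this
      rw [mem_twoSets] at hX hY hZ
      exact (bool _ _ _ hX hY hZ).1 (by simpa using this)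
  · rintro ⟨hI, hh⟩ X Y Z hP
    rw [mem_LO_three_iff]
    simp only [Matrix.cons_val]
    have d1 : Disjoint X Y := Finset.disjoint_left.2 fun a => by have := hP a; grind
    have d2 : Disjoint X Z := Finset.disjoint_left.2 fun a => by have := hP a; grind
    have d3 : Disjoint Y Z := Finset.disjoint_left.2 fun a => by have := hP a; grind
    have i1 := fun h1 h2 => hI X h1 Y h2 d1
    have i2 := fun h1 h2 => hI X h1 Z h2 d2
    have i3 := fun h1 h2 => hI Y h1 Z h2 d3
    have h1 := hh X Y Z hP
    simp only [mem_twoSets] at i1 i2 i3 h1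
    by_cases h2 : val f X = 2 ∨ val f Y = 2 ∨ val f Z = 2
    · exact two _ _ _ h2 i1 i2 i3
    · push Not at h2
      exact (bool _ _ _ h2.1 h2.2.1 h2.2.2).2 (h1 h2.1 h2.2.1 h2.2.2)

/-- Fewer boolean sets mean fewer constraints, so only intersection has to be checked. The case `Y =
X` of the hypothesis excludes `X = ∅`. -/
theorem IsLOPol.recolour_two (hf : IsLOPol f) {X : Finset (Fin n)}
    (hX : ∀ Y ∈ insert X (twoSets f), ¬ Disjoint X Y) : IsLOPol (recolour f X 2) := by
  have ht : ∀ Y, Y ∈ twoSets (recolour f X 2) ↔ Y = X ∨ Y ∈ twoSets f := fun Y => by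
    rw [mem_twoSets, mem_twoSets, val_recolour]
    split_ifs with h <;> simp [h]
  rw [isLOPol_iff] at hf ⊢
  refine ⟨fun Y hY Z hZ => ?_, fun A B C hP hA hB hC => ?_⟩
  · rw [ht] at hY hZ
    rcases hY with rfl | hY
    · exact hX Z (by grind)
    · rcases hZ with rfl | hZ
      · rw [disjoint_comm]; exact hX Y (by grind)
      · exact hf.1 Y hY Z hZ
  · rw [ht, not_or] at hA hB hC
    have := hf.2 A B C hP hA.2 hB.2 hC.2
    simpa [ind, val_recolour, hA.1, hB.1, hC.1] using this

theorem ind_recolour {X Y : Finset (Fin n)} {i : Fin 3} :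
    ind (recolour f X i) Y = if Y = X then (if i = 1 then 1 else 0) else ind f Y := by
  simp only [ind, val_recolour]
  split_ifs <;> rfl

theorem twoSets_recolour {X : Finset (Fin n)} {i : Fin 3} (hX : X ∉ twoSets f) (hi : i ≠ 2) :
    twoSets (recolour f X i) = twoSets f := by
  ext Y
  rw [mem_twoSets, mem_twoSets, val_recolour]
  rw [mem_twoSets] at hX
  split_ifs with h
  · subst h; simp [hi, hX]
  · rfl

/-- A boolean set is recolourable to the opposite value unless it lies in a tripartition into
boolean sets. -/
theorem isLOPol_recolour_iff (hf : IsLOPol f) {X : Finset (Fin n)} {i : Fin 3}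
    (hX : val f X ≠ 2) (hi : i ≠ 2) (hiX : i ≠ val f X) :
    IsLOPol (recolour f X i) ↔
      ¬ ∃ Y Z, Tripartition X Y Z ∧ X ∉ twoSets f ∧ Y ∉ twoSets f ∧ Z ∉ twoSets f := by
  have hX' : X ∉ twoSets f := by rwa [mem_twoSets]
  have hflip : (if i = 1 then 1 else 0) + ind f X = 1 := by
    unfold ind
    split_ifs <;> omega
  rw [isLOPol_iff] at hf ⊢
  rw [twoSets_recolour hX' hi]
  constructor
  · rintro ⟨-, hh⟩ ⟨Y, Z, hP, -, hY, hZ⟩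
    have e1 := hh X Y Z hP hX' hY hZ
    have e2 := hf.2 X Y Z hP hX' hY hZ
    simp only [ind_recolour] at e1
    simp only [if_true] at e1
    generalize (if i = 1 then 1 else 0) = k at *
    split_ifs at e1 with h1 h2 h2
    · subst h1 h2; omega
    · subst h1; omega
    · subst h2; omega
    · omega
  · intro hno
    refine ⟨hf.1, fun A B C hP hA hB hC => ?_⟩
    have hAX : A ≠ X := by rintro rfl; exact hno ⟨B, C, hP, hA, hB, hC⟩
    have hBX : B ≠ X := by
      rintro rfl
      exact hno ⟨A, C, fun a => by have := hP a; grind, hB, hA, hC⟩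
    have hCX : C ≠ X := by
      rintro rfl
      exact hno ⟨A, B, fun a => by have := hP a; grind, hC, hA, hB⟩
    simpa only [ind_recolour, hAX, hBX, hCX, if_false] using hf.2 A B C hP hA hB hC

theorem isStatic_iff (hf : IsLOPol f) {X : Finset (Fin n)} : IsStatic f X ↔
    ∃ Y Z, Tripartition X Y Z ∧ X ∉ twoSets f ∧ Y ∉ twoSets f ∧ Z ∉ twoSets f := by
  by_cases h2 : val f X = 2
  · simp [IsStatic, mem_twoSets, h2]
  · have h01 : val f X = 0 ∨ val f X = 1 := by omega
    rcases h01 with h | h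
    · simp only [IsStatic, Recolourable, isLOPol_recolour_iff hf h2 (i := 1) (by decide)
        (by rw [h]; decide), h]
      simp
    · simp only [IsStatic, Recolourable, isLOPol_recolour_iff hf h2 (i := 0) (by decide)
        (by rw [h]; decide), h]
      simp

theorem isRecolouredProjection_iff (hf : IsLOPol f) {t : Fin n} :
    IsRecolouredProjection f t ↔ Dictates (twoSets f) (ind f) t := by
  simp only [IsRecolouredProjection, isStatic_iff hf, hf, true_and]
  constructor
  · intro h X Y Z hP hX hY hZ htX
    simp [ind, h X ⟨Y, Z, hP, hX, hY, hZ⟩, htX]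
  · rintro h X ⟨Y, Z, hP, hX, hY, hZ⟩
    have hh := (isLOPol_iff.1 hf).2 X Y Z hP hX hY hZ
    have h1 := h X Y Z hP hX hY hZ
    have h2 := h Y X Z (fun a => by have := hP a; grind) hY hX hZ
    have h3 := h Z X Y (fun a => by have := hP a; grind) hZ hX hY
    rw [mem_twoSets] at hX
    split_ifs with ht
    · have := h1 ht
      simp only [ind] at this
      by_contra hne
      simp [hne] at this
    · have hX0 : ind f X = 0 := by
        have := hP t
        by_cases htY : t ∈ Y
        · have := h2 htY; omega
        · have := h3 (by grind); omega
      have : val f X ≠ 1 := fun h => by simp [ind, h] at hX0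
      omega

/-! ### Saturations -/

theorem IsSaturation.agree (h : IsSaturation f g) (X : Finset (Fin n)) :
    val g X = 2 ∨ val g X = val f X := by
  obtain ⟨-, -, h⟩ := h
  induction h with
  | refl => exact Or.inr rfl
  | tail _ h ih =>
    obtain ⟨Y, -, -, rfl⟩ := h
    rw [val_recolour]
    split_ifs
    · exact Or.inl rfl
    · exact ih

theorem IsSaturation.twoSets_subset (h : IsSaturation f g) : twoSets f ⊆ twoSets g := by
  intro X hX
  rw [mem_twoSets] at hX ⊢
  rcases h.agree X with h | h
  · exact h
  · rw [h, hX]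

theorem IsSaturation.ind_eq (h : IsSaturation f g) {X : Finset (Fin n)} (hX : X ∉ twoSets g) :
    ind f X = ind g X := by
  rw [mem_twoSets] at hX
  simp [ind, (h.agree X).resolve_left hX]

/-- All saturations can thus be compared through the one value function `ind f`; only their games
differ. -/
theorem IsSaturation.dictates_iff (h : IsSaturation f g) {t : Fin n} :
    Dictates (twoSets g) (ind g) t ↔ Dictates (twoSets g) (ind f) t := by
  constructor <;> intro hd X Y Z hP hX hY hZ ht
  · rw [h.ind_eq hX]; exact hd X Y Z hP hX hY hZ ht
  · rw [← h.ind_eq hX]; exact hd X Y Z hP hX hY hZ ht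

theorem IsSaturated.isGame (hg : IsSaturated g) : IsGame (twoSets g) := by
  obtain ⟨hp, hup, hc⟩ := hg
  have hI := (isLOPol_iff.1 hp).1
  refine ⟨fun X Y hX hXY => ?_, fun X => ⟨fun hX hXc => hI X hX _ hXc disjoint_compl_right,
    fun hXc => ?_⟩⟩
  · rw [mem_twoSets] at hX ⊢
    exact hup X Y hX hXY
  · rw [mem_twoSets] at hXc ⊢
    rw [← compl_compl X]
    refine hc _ ?_
    unfold IsBoolean
    omega

theorem IsGame.isSaturated (hg : IsLOPol g) (h : IsGame (twoSets g)) : IsSaturated g := by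
  refine ⟨hg, fun X Y hX hXY => mem_twoSets.1 (h.up X Y (mem_twoSets.2 hX) hXY), fun X hX => ?_⟩
  have hX' : X ∉ twoSets g := by
    rw [mem_twoSets]
    rcases hX with h | h <;> rw [h] <;> decide
  exact mem_twoSets.1 (h.win_of_cover hX' subset_rfl)

theorem NoSmallTwoSet.four_le (h : NoSmallTwoSet f) : ∀ X ∈ twoSets f, 4 ≤ X.card :=
  fun X hX => h X (mem_twoSets.1 hX)

/-- Any intersecting family containing the `2`-sets is reached by recolouring. -/
theorem IsLOPol.exists_recolouring (hf : IsLOPol f) {T : Finset (Finset (Fin n))}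
    (hT : ∀ X ∈ T, ∀ Y ∈ T, ¬ Disjoint X Y) (hfT : twoSets f ⊆ T) :
    ∃ g, Relation.ReflTransGen TwoStep f g ∧ IsLOPol g ∧ twoSets g = T := by
  induction hm : (T \ twoSets f).card using Nat.strong_induction_on generalizing f with
  | _ m ih =>
    subst hm
    by_cases hsub : T ⊆ twoSets f
    · exact ⟨f, .refl, hf, hfT.antisymm hsub⟩
    · obtain ⟨X, hXT, hX⟩ := Finset.not_subset.1 hsub
      have hf' : IsLOPol (recolour f X 2) := hf.recolour_two fun Y hY => by
        refine hT X hXT Y ?_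
        rcases Finset.mem_insert.1 hY with rfl | hY
        · exact hXT
        · exact hfT hY
      have ht : ∀ Y, Y ∈ twoSets (recolour f X 2) ↔ Y = X ∨ Y ∈ twoSets f := fun Y => by
        rw [mem_twoSets, mem_twoSets, val_recolour]
        split_ifs with h <;> simp [h]
      obtain ⟨g, h1, h2, h3⟩ := ih _ (Finset.card_lt_card ⟨fun Y hY => by grind, fun h => by
          have := h (Finset.mem_sdiff.2 ⟨hXT, hX⟩)
          grind⟩) hf' (fun Y hY => by rcases (ht Y).1 hY with rfl | h
                                      · exact hXT
                                      · exact hfT h) rfl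
      rw [mem_twoSets] at hX
      refine ⟨g, .head ⟨X, ?_, ⟨Ne.symm hX, hf'⟩, rfl⟩ h1, h2, h3⟩
      unfold IsBoolean
      omega

/-- From arity seven on, polymorphisms without small `2`-sets have pure saturations. -/
theorem IsLOPol.exists_isPureSaturation (hf : IsLOPol f) (hsmall : NoSmallTwoSet f)
    (hn : 7 ≤ n) : ∃ g, IsPureSaturation f g := by
  have : NeZero n := ⟨by omega⟩
  have hI := (isLOPol_iff.1 hf).1
  -- These are the complements of small sets. They meet all sets of at least four elements, and each
  -- other because `n ≥ 7`; making them all 2-sets rules out small 2-sets.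
  let L : Finset (Finset (Fin n)) := Finset.univ.filter fun X => n ≤ X.card + 3
  have large : ∀ X Y : Finset (Fin n), 4 ≤ X.card → n ≤ Y.card + 3 → ¬ Disjoint X Y := by
    intro X Y hX hY hXY
    have h1 := Finset.card_union_of_disjoint hXY
    have h2 := Finset.card_le_univ (X ∪ Y)
    rw [Fintype.card_fin] at h2
    omega
  have hFL : ((twoSets f ∪ L : Finset (Finset (Fin n))) : Set (Finset (Fin n))).Intersecting := by
    intro X hX Y hY
    rw [Finset.mem_coe, Finset.mem_union] at hX hY
    simp only [L, Finset.mem_filter, Finset.mem_univ, true_and] at hX hY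
    rcases hX with hX | hX
    · rcases hY with hY | hY
      · exact hI X hX Y hY
      · exact large X Y (hsmall.four_le X hX) hY
    · rcases hY with hY | hY
      · rw [disjoint_comm]; exact large Y X (hsmall.four_le Y hY) hX
      · exact large X Y (by omega) hY
  obtain ⟨T, hsub, hcard, hT⟩ := hFL.exists_card_eq
  have hmax := hT.is_max_iff_card_eq.2 hcard
  have hup := hT.isUpperSet' hmax
  have hL : ∀ X : Finset (Fin n), n ≤ X.card + 3 → X ∈ T := fun X hX =>
    hsub (Finset.mem_union_right _ (by simpa [L] using hX))
  obtain ⟨g, h1, h2, h3⟩ := hf.exists_recolouring (T := T)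
    (fun X hX Y hY => hT hX hY) (Finset.subset_union_left.trans hsub)
  have hG : IsGame T := by
    refine ⟨fun X Y hX hXY => hup hXY hX, fun X => ⟨fun h => hT.compl_notMem h, fun hXc => ?_⟩⟩
    by_contra hX
    refine T.ne_insert_of_notMem _ hX (hmax _ ?_ (T.subset_insert X))
    rw [Finset.coe_insert]
    refine hT.insert ?_ fun Y hY hXY => hXc (hup hXY.le_compl_left hY)
    rintro rfl
    exact hXc (hL _ (by simp))
  refine ⟨g, ⟨hf, IsGame.isSaturated h2 (h3 ▸ hG), h1⟩, fun X hX => ?_⟩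
  by_contra! hc
  refine (hG.compl X).1 (h3 ▸ mem_twoSets.2 hX) (hL _ ?_)
  rw [Finset.card_compl, Fintype.card_fin]
  omega

/-- In small arity the dictating variable is unique. -/
theorem existsUnique_isRecolouredProjection (hf : IsLOPol f) (hsmall : NoSmallTwoSet f)
    (hn : n ≤ 6) : ∃! t, IsRecolouredProjection f t := by
  have hh := (isLOPol_iff.1 hf).2
  have hF : ∀ X : Finset (Fin n), X.card ≤ 3 → X ∉ twoSets f := fun X hX h => by
    have := hsmall.four_le X h
    omega
  obtain ⟨t, ht⟩ := exists_dictator_of_le_six hn fun X Y Z hP hX hY hZ =>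
    hh X Y Z hP (hF X hX) (hF Y hY) (hF Z hZ)
  refine ⟨t, (isRecolouredProjection_iff hf).2 fun X Y Z hP hX hY hZ htX => ?_, fun s hs => ?_⟩
  · have e := hh X Y Z hP hX hY hZ
    by_cases hX3 : X.card ≤ 3
    · rw [ht X hX3, if_pos htX]
    -- A part with more than three of at most six elements leaves at most two for the others.
    · have hd : ∀ A, Disjoint X A → A.card ≤ 3 := fun A hA => by
        have h1 := Finset.card_union_of_disjoint hA
        have h2 := Finset.card_le_univ (X ∪ A)
        rw [Fintype.card_fin] at h2
        omega
      have htP := hP t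
      have hY0 := ht Y (hd Y (Finset.disjoint_left.2 fun a => by have := hP a; grind))
      have hZ0 := ht Z (hd Z (Finset.disjoint_left.2 fun a => by have := hP a; grind))
      rw [if_neg (by grind)] at hY0 hZ0
      omega
  · by_contra hst
    replace hs := (isRecolouredProjection_iff hf).1 hs
    have hc : ({t}ᶜ : Finset (Fin n)).card = n - 1 := by
      rw [Finset.card_compl, Fintype.card_fin, Finset.card_singleton]
    -- The at most five elements other than `t` split into parts of at most three and two elements,
    -- all of value 0; a second dictator would lie in one of them.
    obtain ⟨Y, hY, hYc⟩ := Finset.exists_subset_card_eq (s := ({t}ᶜ : Finset (Fin n)))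
      (n := min 3 (n - 1)) (by omega)
    have hZc := Finset.card_sdiff_add_card_eq_card hY
    have hP : Tripartition {t} Y ({t}ᶜ \ Y) := fun a => by
      have := @hY a
      grind [Finset.mem_compl]
    have l1 := hF {t} (by simp)
    have hY3 : Y.card ≤ 3 := by omega
    have hZ3 : ({t}ᶜ \ Y).card ≤ 3 := by omega
    have htY : t ∉ Y := fun h => by simpa using hY h
    have htZ : t ∉ ({t}ᶜ : Finset (Fin n)) \ Y := by simp
    have hsP := hP s
    by_cases hsY : s ∈ Y
    · have e1 := hs Y {t} _ (fun a => by have := hP a; grind) (hF _ hY3) l1 (hF _ hZ3) hsY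
      have e2 := ht Y hY3
      rw [if_neg htY] at e2
      omega
    · have e1 := hs _ {t} Y (fun a => by have := hP a; grind) (hF _ hZ3) l1 (hF _ hY3)
        (by grind)
      have e2 := ht _ hZ3
      rw [if_neg htZ] at e2
      omega

end LOPoly

/-! ### The theorem in large and small arity -/

theorem mainTheorem2 (n : ℕ) (f : (Fin n → Fin 2) → Fin 3) (hf : LOPoly.IsLOPol f)
    (hsmall : LOPoly.NoSmallTwoSet f) :
    ∃! t : Fin n,
      (n ≤ 6 ∧ LOPoly.IsRecolouredProjection f t) ∨
      (7 ≤ n ∧ ∀ g : (Fin n → Fin 2) → Fin 3, LOPoly.IsPureSaturation f g →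
        LOPoly.IsRecolouredProjection g t) := by
  rcases Nat.lt_or_ge 6 n with hn | hn
  · have hh := (LOPoly.isLOPol_iff.1 hf).2
    have main : ∀ g, LOPoly.IsPureSaturation f g →
        LOPoly.IsGame (LOPoly.twoSets g) ∧ LOPoly.twoSets f ⊆ LOPoly.twoSets g ∧
        ∀ t, LOPoly.IsRecolouredProjection g t ↔
          LOPoly.Dictates (LOPoly.twoSets g) (LOPoly.ind f) t := fun g hg =>
      ⟨hg.1.2.1.isGame, hg.1.twoSets_subset, fun t => by
        rw [LOPoly.isRecolouredProjection_iff hg.1.2.1.1, hg.1.dictates_iff]⟩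
    -- One fixed pure saturation determines `t`; without any, the condition on `t` would be vacuous.
    obtain ⟨g, hg⟩ := hf.exists_isPureSaturation hsmall hn
    obtain ⟨hG, hfg, hgt⟩ := main g hg
    obtain ⟨t, ht⟩ := hG.exists_dictates hg.2.four_le (hh.mono hfg)
    refine ⟨t, Or.inr ⟨hn, fun g' hg' => ?_⟩, fun s hs => ?_⟩
    · obtain ⟨hG', hfg', hgt'⟩ := main g' hg'
      obtain ⟨r, hr⟩ := hG'.exists_dictates hg'.2.four_le (hh.mono hfg')
      rw [hgt', LOPoly.Dictates.eq hh hG' hg'.2.four_le hfg' hr hG hg.2.four_le hfg ht]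
      exact hr
    · rcases hs with ⟨h6, -⟩ | ⟨-, hs⟩
      · omega
      · exact LOPoly.Dictates.eq hh hG hg.2.four_le hfg ht hG hg.2.four_le hfg
          ((hgt s).1 (hs g hg))
  · obtain ⟨t, ht, hu⟩ := LOPoly.existsUnique_isRecolouredProjection hf hsmall hn
    refine ⟨t, Or.inl ⟨hn, ht⟩, fun s hs => ?_⟩
    rcases hs with ⟨-, hs⟩ | ⟨h7, -⟩
    · exact hu s hs
    · omega
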